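/- Let $G$ be any (simple, undirected) graph, of arbitrary cardinality and not necessarily connected. A ray of $G$ is a one-way infinite path in $G$; two rays are equivalent if for every finite $X\subseteq V(G)$ they have tails in the same component of $G-X$, and the ends of $G$ are the equivalence classes of rays. For a finite set $X\subseteq V(G)$ and a component $C$ of $G-X$ let $\Omega(X,C)$ be the set of ends of $G$ all of whose rays have a tail in $C$. The end space $\Omega(G)$ is the set of ends of $G$ with the topology generated by the sets $\Omega(X,C)$. A direction of $G$ is a map $f$ that assigns to every finite $X\subseteq V(G)$ a component $f(X)$ of $G-X$ such that $f(X)\supseteq f(X')$ whenever $X\subseteq X'$. A directional choice in $G$ is a pair $(X,C)$ of a finite set $X\subseteq V(G)$ and a component $C$ of $G-X$; it distinguishes a direction $f$ from a direction $h$ if $f(X)=C$ and $h(X)\neq C$. The graph $G$ is countably determined if there is a countable set $S$ of directional choices in $G$ such that for all directions $f\neq h$ of $G$ (in either order) some element of $S$ distinguishes $f$ from $h$. Then the end space $\Omega(G)$ is second countable if and only if $G$ is countably determined. -/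

import Mathlib

universe u

namespace SimpleGraph

variable {V : Type u}

/-- A ray of `G`: a one-way infinite path, given by its sequence of pairwise distinct vertices. -/
structure Ray (G : SimpleGraph V) where
  vert : ℕ → V
  injective : Function.Injective vert
  adj : ∀ n, G.Adj (vert n) (vert (n + 1))

namespace Ray

variable {G : SimpleGraph V}

/-- The component `C` of `G - X` contains a tail of the ray `R`. -/
def HasTailIn (R : G.Ray) {X : Finset V} (C : G.ComponentCompl (X : Set V)) : Prop :=
  ∃ n, ∀ m, n ≤ m → R.vert m ∈ C

theorem exists_hasTailIn (R : G.Ray) (X : Finset V) :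
    ∃ C : G.ComponentCompl (X : Set V), R.HasTailIn C := by
  have hfin : (R.vert ⁻¹' (X : Set V)).Finite := X.finite_toSet.preimage R.injective.injOn
  obtain ⟨b, hb⟩ := hfin.bddAbove
  have hout : ∀ m, b + 1 ≤ m → R.vert m ∉ (X : Set V) := by
    intro m hm hmX
    have := hb (show m ∈ R.vert ⁻¹' (X : Set V) from hmX)
    omega
  refine ⟨G.componentComplMk (hout (b + 1) le_rfl), b + 1, fun m hm => ?_⟩
  induction m, hm using Nat.le_induction with
  | base => exact G.componentComplMk_mem _
  | succ k hk ih => exact ComponentCompl.mem_of_adj _ _ ih (hout _ (by omega)) (R.adj k)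

theorem HasTailIn.unique {R : G.Ray} {X : Finset V} {C D : G.ComponentCompl (X : Set V)}
    (hC : R.HasTailIn C) (hD : R.HasTailIn D) : C = D := by
  obtain ⟨n, hn⟩ := hC
  obtain ⟨k, hk⟩ := hD
  by_contra hne
  exact Set.disjoint_left.mp (ComponentCompl.pairwise_disjoint hne)
    (hn (max n k) (le_max_left _ _)) (hk (max n k) (le_max_right _ _))

/-- Two rays are equivalent if no finite vertex set separates them, that is, if for every finite
vertex set `X` both have a tail in the same component of `G - X`. -/
def Equivalent (R S : G.Ray) : Prop :=
  ∀ X : Finset V, ∃ C : G.ComponentCompl (X : Set V), R.HasTailIn C ∧ S.HasTailIn C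

theorem equivalent_equivalence : Equivalence (Equivalent (G := G)) where
  refl R X := (R.exists_hasTailIn X).imp fun _ h => ⟨h, h⟩
  symm h X := (h X).imp fun _ hC => ⟨hC.2, hC.1⟩
  trans h₁ h₂ X := by
    obtain ⟨C, hR, hS⟩ := h₁ X
    obtain ⟨D, hS', hT⟩ := h₂ X
    exact ⟨C, hR, by rwa [hS.unique hS']⟩

instance setoid (G : SimpleGraph V) : Setoid G.Ray := ⟨Equivalent, equivalent_equivalence⟩

end Ray

/-- The set of ends of `G`: the equivalence classes of rays. -/
def EndSpace (G : SimpleGraph V) : Type u := Quotient (Ray.setoid G)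

/-- The set of those ends of `G` that live in the component `C` of `G - X`: every ray of the end
has a tail in `C`. -/
def endsIn (G : SimpleGraph V) (X : Finset V) (C : G.ComponentCompl (X : Set V)) :
    Set G.EndSpace :=
  {ω | ∀ R : G.Ray, Quotient.mk (Ray.setoid G) R = ω → R.HasTailIn C}

/-- The topology of the end space, generated by the sets of the ends living in a component of
`G - X`, for `X` finite. -/
instance EndSpace.topologicalSpace (G : SimpleGraph V) : TopologicalSpace G.EndSpace :=
  TopologicalSpace.generateFrom
    {U | ∃ (X : Finset V) (C : G.ComponentCompl (X : Set V)), U = G.endsIn X C}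

/-- A direction of `G`: a map assigning to every finite vertex set `X` a component of `G - X`, such
that the component of `X` includes that of `X'` whenever `X ⊆ X'`. -/
@[ext]
structure Direction (G : SimpleGraph V) where
  comp : ∀ X : Finset V, G.ComponentCompl (X : Set V)
  anti : ∀ X X' : Finset V, X ⊆ X' → (comp X' : Set V) ⊆ (comp X : Set V)

/-- A directional choice in `G`: a finite vertex set `X` with a component of `G - X`. -/
structure DirectionalChoice (G : SimpleGraph V) where
  X : Finset V
  C : G.ComponentCompl (X : Set V)

/-- The directional choice `(X, C)` distinguishes the direction `f` from the direction `h`. -/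
def DirectionalChoice.Distinguishes {G : SimpleGraph V} (c : G.DirectionalChoice)
    (f h : G.Direction) : Prop :=
  f.comp c.X = c.C ∧ h.comp c.X ≠ c.C

/-- `G` is countably determined: some countable set of directional choices distinguishes every two
directions of `G` from each other (as `f` and `h` range over all ordered pairs, `f` is
distinguished from `h` and `h` from `f`). -/
def CountablyDetermined (G : SimpleGraph V) : Prop :=
  ∃ S : Set G.DirectionalChoice, S.Countable ∧
    ∀ f h : G.Direction, f ≠ h → ∃ c ∈ S, c.Distinguishes f h

end SimpleGraph

/-! Ends and directions coincide: by `Direction.exists_ray` every direction is induced by a ray, so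
the sets `endsIn X C` become conditions `f.comp X = C` on directions. A countable basis of such sets
is then a countable set of directional choices, and it distinguishes directions because distinct
ends differ on some basic open set.

Conversely, let countably many choices distinguish all directions, and enlarge the union of their
vertex sets to a countable linked set `U`. The sets `endsIn X C` with finite `X ⊆ U` and `C` chosen
by a direction form a countable basis, for two reasons. By `countable_comp`, each `X` has only
countably many chosen components: two that avoid `U` and have the same neighbourhood in `X` can be
distinguished only by a choice whose component is one of them. By `exists_subset`, the value of a
direction at any finite `Z` is forced by its value at one finite `X ⊆ U`.

Linkedness is what produces rays: a direction that keeps meeting `U` is followed by a ray inside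
`U`. -/

namespace SimpleGraph

variable {V : Type u} {G : SimpleGraph V}

/-! ### Walks and components -/

namespace ComponentCompl

variable {A B : Set V}

theorem exists_walk {C : G.ComponentCompl A} {u v : V} (hu : u ∈ C) (hv : v ∈ C) :
    ∃ p : G.Walk u v, ∀ w ∈ p.support, w ∈ C := by
  classical
  obtain ⟨huA, rfl⟩ := hu
  obtain ⟨hvA, hvC⟩ := hv
  obtain ⟨q⟩ := ConnectedComponent.exact hvC.symm
  refine ⟨q.map (Embedding.induce _).toHom, fun w hw => ?_⟩
  obtain ⟨x, hx, rfl⟩ := List.mem_map.mp ((Walk.support_map _ q).symm ▸ hw)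
  exact ⟨x.2, (ConnectedComponent.sound ⟨q.takeUntil x hx⟩).symm⟩

theorem mem_of_walk {C : G.ComponentCompl A} {u v : V} (p : G.Walk u v) (hu : u ∈ C)
    (hp : ∀ w ∈ p.support, w ∉ A) : ∀ w ∈ p.support, w ∈ C := by
  induction p with
  | nil => intro w hw; rw [Walk.support_nil, List.mem_singleton] at hw; exact hw ▸ hu
  | cons h p ih =>
    intro w hw
    rw [Walk.support_cons, List.mem_cons] at hw
    have hp' : ∀ w ∈ p.support, w ∉ A := fun w hw => hp w (by simp [hw])
    rcases hw with rfl | hw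
    · exact hu
    · exact ih (mem_of_adj _ _ hu (hp' _ p.start_mem_support) h) hp' w hw

theorem mem_end_of_walk {C : G.ComponentCompl A} {u v : V} (p : G.Walk u v) (hu : u ∈ C)
    (hp : ∀ w ∈ p.support, w ∉ A) : v ∈ C :=
  mem_of_walk p hu hp v p.end_mem_support

/-- A component of `G - A` that avoids `B` is included in every component of `G - B` it meets. -/
theorem subset_of_avoids {C : G.ComponentCompl A} {D : G.ComponentCompl B}
    (hB : ∀ v ∈ C, v ∉ B) {u : V} (hC : u ∈ C) (hD : u ∈ D) {v : V} (hv : v ∈ C) : v ∈ D := by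
  obtain ⟨p, hp⟩ := exists_walk hC hv
  exact mem_end_of_walk p hD fun w hw => hB w (hp w hw)

theorem eq_of_mem {C D : G.ComponentCompl A} {u : V} (hC : u ∈ C) (hD : u ∈ D) : C = D := by
  by_contra hne
  exact Set.disjoint_left.mp (ComponentCompl.pairwise_disjoint hne) hC hD

theorem exists_boundary {C : G.ComponentCompl A} {u v : V} (p : G.Walk u v) {S : Set V}
    (hp : ∀ w ∈ p.support, w ∈ C) (hu : u ∈ S) (hv : v ∉ S) :
    ∃ x y, x ∈ C ∧ y ∈ C ∧ x ∈ S ∧ y ∉ S ∧ G.Adj x y := by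
  obtain ⟨d, hd, h₁, h₂⟩ := p.exists_boundary_dart S hu hv
  exact ⟨d.fst, d.snd, hp _ (p.dart_fst_mem_support_of_mem_darts hd),
    hp _ (p.dart_snd_mem_support_of_mem_darts hd), h₁, h₂, d.adj⟩

end ComponentCompl

/-! ### Extracting rays -/

/-- An infinite walk that visits every vertex only finitely often contains a ray. -/
theorem exists_ray_of_infinite_walk (w : ℕ → V) (hadj : ∀ i, G.Adj (w i) (w (i + 1)))
    (hfin : ∀ v, ∃ n, ∀ i, n ≤ i → w i ≠ v) :
    ∃ (R : G.Ray) (t : ℕ → ℕ), StrictMono t ∧ ∀ n, R.vert n = w (t n) := by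
  -- Each visited vertex has a last visit. The ray continues from there, so it never returns to a
  -- vertex.
  have hlast : ∀ i, ∃ j, i ≤ j ∧ w j = w i ∧ ∀ k, j < k → w k ≠ w i := by
    intro i
    classical
    obtain ⟨n, hn⟩ := hfin (w i)
    have hi : i ≤ n := by
      by_contra! h
      exact hn i h.le rfl
    refine ⟨Nat.findGreatest (fun j => w j = w i) n, Nat.le_findGreatest hi rfl,
      Nat.findGreatest_spec (P := fun j => w j = w i) hi rfl, fun k hk => ?_⟩
    rcases le_total n k with h | h
    · exact hn k h
    · exact Nat.findGreatest_is_greatest hk h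
  choose L hL hwL hmax using hlast
  let t : ℕ → ℕ := fun n => Nat.rec (L 0) (fun _ s => L (s + 1)) n
  have ht : ∀ n, t (n + 1) = L (t n + 1) := fun n => rfl
  have hmono : StrictMono t := strictMono_nat_of_lt_succ fun n => by
    rw [ht]; exact hL (t n + 1)
  have hmax' : ∀ n k, t n < k → w k ≠ w (t n) := by
    intro n k hk
    cases n with
    | zero => exact fun h => hmax 0 k hk (h.trans (hwL 0))
    | succ n => exact fun h => hmax (t n + 1) k hk (h.trans (hwL (t n + 1)))
  refine ⟨⟨fun n => w (t n), ?_, fun n => ?_⟩, t, hmono, fun n => rfl⟩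
  · intro a b hab
    by_contra hne
    rcases lt_or_gt_of_ne hne with h | h
    · exact hmax' a _ (hmono h) hab.symm
    · exact hmax' b _ (hmono h) hab
  · rw [ht, hwL]
    exact hadj (t n)

/-- Finite walks, the `n`-th of which joins `v n` to `v (n + 1)` in `A n`, concatenate to an infinite
walk that eventually stays in each `A n`. -/
theorem exists_infinite_walk_of_antitone (A : ℕ → Set V) (hanti : Antitone A) (v : ℕ → V)
    (hne : ∀ n, v n ≠ v (n + 1))
    (hQ : ∀ n, ∃ p : G.Walk (v n) (v (n + 1)), ∀ x ∈ p.support, x ∈ A n) :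
    ∃ w : ℕ → V, (∀ i, G.Adj (w i) (w (i + 1))) ∧ ∀ n, ∃ k, ∀ i, k ≤ i → w i ∈ A n := by
  choose Q hQ using hQ
  let P : ∀ n, G.Walk (v 0) (v n) :=
    fun n => Nat.rec Walk.nil (fun n p => p.append (Q n)) n
  have hP : ∀ n, P (n + 1) = (P n).append (Q n) := fun n => rfl
  have hlen1 : ∀ n, (P n).length < (P (n + 1)).length := by
    intro n
    rw [hP, Walk.length_append]
    have : (Q n).length ≠ 0 := fun h => hne n (Walk.eq_of_length_eq_zero h)
    omega
  have hlen : ∀ n, n ≤ (P n).length :=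
    fun n => (strictMono_nat_of_lt_succ hlen1).id_le n
  have hprefix : ∀ n m i, n ≤ m → i ≤ (P n).length → (P m).getVert i = (P n).getVert i := by
    intro n m i hnm hi
    induction m, hnm using Nat.le_induction with
    | base => rfl
    | succ m hm ih =>
      have hle : (P n).length ≤ (P m).length := (strictMono_nat_of_lt_succ hlen1).monotone hm
      rw [hP, Walk.getVert_append, ← ih]
      split_ifs with h
      · rfl
      · have : i = (P m).length := by omega
        rw [this]; simp
  have htail : ∀ n m i, n ≤ m → (P n).length ≤ i → i ≤ (P m).length → (P m).getVert i ∈ A n := by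
    intro n m i hnm hi
    induction m, hnm using Nat.le_induction with
    | base =>
      intro hi'
      rw [le_antisymm hi' hi, Walk.getVert_length]
      exact hQ n _ (Q n).start_mem_support
    | succ m hm ih =>
      intro _
      rw [hP, Walk.getVert_append]
      split_ifs with h
      · exact ih h.le
      · exact hanti hm (hQ m _ (Walk.getVert_mem_support _ _))
  -- The walks `P n` extend one another and `P i` has length at least `i`, so the diagonal reads off
  -- their common limit.
  refine ⟨fun i => (P i).getVert i, fun i => ?_, fun n => ⟨(P n).length, fun i hi => ?_⟩⟩
  · dsimp only
    rw [← hprefix i (i + 1) i (Nat.le_succ i) (hlen i)]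
    exact (P (i + 1)).adj_getVert_succ (hlen (i + 1))
  · exact htail n i i ((hlen n).trans hi) hi (hlen i)

/-- A decreasing sequence of nonempty connected vertex sets with empty intersection is followed by
a ray. -/
theorem exists_ray_of_antitone (A : ℕ → Set V) (hanti : Antitone A) (hA : ∀ n, (A n).Nonempty)
    (hconn : ∀ n, ∀ u ∈ A n, ∀ v ∈ A n, ∃ p : G.Walk u v, ∀ x ∈ p.support, x ∈ A n)
    (hempty : ∀ v, ∃ n, v ∉ A n) :
    ∃ R : G.Ray, ∀ n, ∃ k, ∀ m, k ≤ m → R.vert m ∈ A n := by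
  -- Moving on to an index whose set has lost the current vertex makes consecutive vertices
  -- distinct.
  have hstep : ∀ s : {s : ℕ × V // s.2 ∈ A s.1}, ∃ s' : {s : ℕ × V // s.2 ∈ A s.1},
      s.1.1 < s'.1.1 ∧ s.1.2 ∉ A s'.1.1 := by
    rintro ⟨⟨n, v⟩, hv⟩
    obtain ⟨k, hk⟩ := hempty v
    obtain ⟨v', hv'⟩ := hA (max k (n + 1))
    exact ⟨⟨(max k (n + 1), v'), hv'⟩, by simp,
      fun h => hk (hanti (le_max_left _ _) h)⟩
  choose next hlt hnot using hstep
  obtain ⟨v₀, hv₀⟩ := hA 0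
  let s : ℕ → {s : ℕ × V // s.2 ∈ A s.1} := fun n => next^[n] ⟨(0, v₀), hv₀⟩
  have hs : ∀ n, s (n + 1) = next (s n) := fun n => Function.iterate_succ_apply' _ _ _
  have hmono : StrictMono fun n => (s n).1.1 := strictMono_nat_of_lt_succ fun n => by
    rw [hs]; exact hlt _
  obtain ⟨w, hadj, htail⟩ := exists_infinite_walk_of_antitone (G := G) (fun n => A (s n).1.1)
    (fun a b hab => hanti (hmono.monotone hab)) (fun n => (s n).1.2)
    (fun n h => by
      have h1 := hnot (s n)
      rw [← hs, h] at h1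
      exact h1 (s (n + 1)).2)
    (fun n => hconn _ _ (s n).2 _ (hanti (hmono.monotone (Nat.le_succ n)) (s (n + 1)).2))
  have htail' : ∀ n, ∃ k, ∀ i, k ≤ i → w i ∈ A n := by
    intro n
    obtain ⟨k, hk⟩ := htail n
    exact ⟨k, fun i hi => hanti (hmono.id_le n) (hk i hi)⟩
  obtain ⟨R, t, ht, hR⟩ := exists_ray_of_infinite_walk w hadj (by
    intro v
    obtain ⟨n, hn⟩ := hempty v
    obtain ⟨k, hk⟩ := htail' n
    exact ⟨k, fun i hi h => hn (h ▸ hk i hi)⟩)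
  refine ⟨R, fun n => ?_⟩
  obtain ⟨k, hk⟩ := htail' n
  exact ⟨k, fun m hm => hR m ▸ hk _ (hm.trans (ht.id_le m))⟩

/-! ### Linked vertex sets -/

/-- A vertex set `U` is linked if deleting finitely many vertices of `U` leaves any two vertices of
`U` that are connected in the remaining graph connected inside `U`. -/
def Linked (G : SimpleGraph V) (U : Set V) : Prop :=
  ∀ X : Finset V, (X : Set V) ⊆ U → ∀ C : G.ComponentCompl (X : Set V),
    ∀ u ∈ U, ∀ v ∈ U, u ∈ C → v ∈ C →
      ∃ p : G.Walk u v, ∀ w ∈ p.support, w ∈ U ∧ w ∈ C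

/-- Every countable set is included in a countable set closed under a given finitary operation with
countable values. -/
theorem exists_countable_closed (A : Set V) (hA : A.Countable) (g : Finset V → Set V)
    (hg : ∀ F, (g F).Countable) :
    ∃ U : Set V, A ⊆ U ∧ U.Countable ∧ ∀ F : Finset V, (F : Set V) ⊆ U → g F ⊆ U := by
  let step : Set V → Set V := fun B => B ∪ ⋃ F ∈ {F : Finset V | (F : Set V) ⊆ B}, g F
  have hmono : Monotone fun n => step^[n] A := monotone_nat_of_le_succ fun n => by
    rw [Function.iterate_succ_apply']
    exact Set.subset_union_left
  refine ⟨⋃ n, step^[n] A, Set.subset_iUnion (fun n => step^[n] A) 0,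
    Set.countable_iUnion fun n => ?_, fun F hF => ?_⟩
  · induction n with
    | zero => exact hA
    | succ n ih =>
      rw [Function.iterate_succ_apply']
      refine ih.union (Set.Countable.biUnion ?_ fun F _ => hg F)
      have := Set.countable_ofPred_finite_subset ih
      refine Set.MapsTo.countable_of_injOn (f := fun F : Finset V => (F : Set V)) ?_
        Finset.coe_injective.injOn this
      exact fun F hF => ⟨F.finite_toSet, hF⟩
  · obtain ⟨n, hn⟩ : ∃ n, (F : Set V) ⊆ step^[n] A :=
      (hmono.directed_le).exists_mem_subset_of_finset_subset_biUnion hF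
    refine subset_trans ?_ (Set.subset_iUnion _ (n + 1))
    rw [Function.iterate_succ_apply']
    exact subset_trans (Set.subset_biUnion_of_mem (u := g) hn) Set.subset_union_right

/-- Closing off under one chosen walk for each finite `X` and each pair of vertices in a common
component of `G - X` suffices. The extra operation `g` lets further witnesses be put into `U`. -/
theorem exists_countable_linked (A : Set V) (hA : A.Countable) (g : Finset V → Set V)
    (hg : ∀ F, (g F).Countable) :
    ∃ U : Set V, A ⊆ U ∧ U.Countable ∧ G.Linked U ∧ ∀ F : Finset V, (F : Set V) ⊆ U → g F ⊆ U := by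
  classical
  have hW : ∀ (X : Finset V) (u v : V), ∃ S : Set V, S.Countable ∧
      ∀ C : G.ComponentCompl (X : Set V), u ∈ C → v ∈ C →
        ∃ p : G.Walk u v, ∀ w ∈ p.support, w ∈ S ∧ w ∈ C := by
    intro X u v
    by_cases h : ∃ C : G.ComponentCompl (X : Set V), u ∈ C ∧ v ∈ C
    · obtain ⟨C, hu, hv⟩ := h
      obtain ⟨p, hp⟩ := ComponentCompl.exists_walk hu hv
      refine ⟨{w | w ∈ p.support}, (List.finite_toSet _).countable, fun D hD _ => ⟨p, ?_⟩⟩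
      rw [ComponentCompl.eq_of_mem hD hu]
      exact fun w hw => ⟨hw, hp w hw⟩
    · exact ⟨∅, Set.countable_empty, fun C hu hv => (h ⟨C, hu, hv⟩).elim⟩
  choose W hWc hW using hW
  obtain ⟨U, hAU, hU, hcl⟩ := exists_countable_closed A hA
    (fun F => g F ∪ ⋃ X ∈ F.powerset, ⋃ u ∈ F, ⋃ v ∈ F, W X u v) (fun F =>
      (hg F).union (F.powerset.countable_toSet.biUnion fun X _ => F.countable_toSet.biUnion
        fun u _ => F.countable_toSet.biUnion fun v _ => hWc X u v))
  refine ⟨U, hAU, hU, ?_, fun F hF => Set.subset_union_left.trans (hcl F hF)⟩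
  intro X hX C u hu v hv huC hvC
  obtain ⟨p, hp⟩ := hW X u v C huC hvC
  refine ⟨p, fun w hw => ⟨?_, (hp w hw).2⟩⟩
  refine hcl (insert u (insert v X)) ?_ (Or.inr ?_)
  · intro x hx
    simp only [Finset.coe_insert, Set.mem_insert_iff] at hx
    rcases hx with rfl | rfl | hx
    exacts [hu, hv, hX hx]
  · simp only [Set.mem_iUnion]
    exact ⟨X, Finset.mem_powerset.mpr fun x hx => by simp [hx], u, by simp, v, by simp,
      (hp w hw).1⟩

/-! ### Directions and rays -/

theorem Direction.exists_mem_inter (f : G.Direction) (X Y : Finset V) :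
    ∃ v, v ∈ f.comp X ∧ v ∈ f.comp Y := by
  classical
  obtain ⟨v, hv⟩ := (f.comp (X ∪ Y)).nonempty
  exact ⟨v, f.anti _ _ Finset.subset_union_left hv, f.anti _ _ Finset.subset_union_right hv⟩

/-- If `f X` avoids `Y`, then `f X` is included in `f Y`. -/
theorem Direction.mem_of_avoids (f : G.Direction) {X Y : Finset V}
    (h : ∀ v ∈ f.comp X, v ∉ (Y : Set V)) {v : V} (hv : v ∈ f.comp X) : v ∈ f.comp Y := by
  obtain ⟨u, hX, hY⟩ := f.exists_mem_inter X Y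
  exact ComponentCompl.subset_of_avoids h hX hY hv

/-- The direction induced by a ray. -/
noncomputable def Ray.direction (R : G.Ray) : G.Direction where
  comp X := (R.exists_hasTailIn X).choose
  anti X X' h := by
    obtain ⟨n, hn⟩ := (R.exists_hasTailIn X).choose_spec
    obtain ⟨k, hk⟩ := (R.exists_hasTailIn X').choose_spec
    intro v hv
    refine ComponentCompl.subset_of_avoids (u := R.vert (max n k)) (fun w hw hwX => ?_)
      (hk _ (le_max_right _ _)) (hn _ (le_max_left _ _)) hv
    exact ComponentCompl.notMem_of_mem hw (h hwX)

theorem Ray.direction_comp_eq_iff {R : G.Ray} {X : Finset V} {C : G.ComponentCompl (X : Set V)} :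
    R.direction.comp X = C ↔ R.HasTailIn C := by
  have h : R.HasTailIn (R.direction.comp X) := (R.exists_hasTailIn X).choose_spec
  exact ⟨fun e => e ▸ h, fun h' => h.unique h'⟩

theorem Ray.direction_eq_iff {R S : G.Ray} : R.direction = S.direction ↔ R.Equivalent S := by
  refine ⟨fun h X => ⟨R.direction.comp X, Ray.direction_comp_eq_iff.mp rfl,
    Ray.direction_comp_eq_iff.mp (by rw [h])⟩, fun h => Direction.ext (funext fun X => ?_)⟩
  obtain ⟨C, hR, hS⟩ := h X
  rw [Ray.direction_comp_eq_iff.mpr hR, Ray.direction_comp_eq_iff.mpr hS]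

/-- If a direction always chooses components meeting a countable linked set `U` when deleting
finitely many vertices of `U`, then some ray follows it along `U`. -/
theorem Direction.exists_ray_of_linked (f : G.Direction) {U : Set V} (hU : U.Countable)
    (hlink : G.Linked U) (hmeet : ∀ X : Finset V, (X : Set V) ⊆ U → ∃ u ∈ U, u ∈ f.comp X) :
    ∃ R : G.Ray, ∀ X : Finset V, (X : Set V) ⊆ U →
      ∃ k, ∀ m, k ≤ m → R.vert m ∈ U ∧ R.vert m ∈ f.comp X := by
  classical
  obtain ⟨u₀, hu₀, -⟩ := hmeet ∅ (by simp)
  obtain ⟨e, rfl⟩ := hU.exists_eq_range ⟨u₀, hu₀⟩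
  -- The `X n` exhaust `U`. The traces of `f.comp (X n)` on `U` are therefore decreasing with empty
  -- intersection, and each is connected by linkedness.
  let X : ℕ → Finset V := fun n => (Finset.range n).image e
  have hX : ∀ n, (X n : Set V) ⊆ Set.range e := fun n => by simp [X]
  have hXmono : Monotone X := fun a b hab =>
    Finset.image_subset_image (Finset.range_subset_range.mpr hab)
  obtain ⟨R, hR⟩ := exists_ray_of_antitone (G := G)
    (fun n => Set.range e ∩ (f.comp (X n) : Set V))
    (fun a b hab => Set.inter_subset_inter_right _ (f.anti _ _ (hXmono hab)))
    (fun n => hmeet _ (hX n))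
    (fun n u hu v hv => hlink _ (hX n) _ u hu.1 v hv.1 hu.2 hv.2)
    (by
      intro v
      by_cases hv : v ∈ Set.range e
      · obtain ⟨n, rfl⟩ := hv
        refine ⟨n + 1, fun h => ComponentCompl.notMem_of_mem h.2 ?_⟩
        exact Finset.mem_coe.mpr (Finset.mem_image_of_mem e (by simp))
      · exact ⟨0, fun h => hv h.1⟩)
  refine ⟨R, fun Y hY => ?_⟩
  obtain ⟨n, hn⟩ : ∃ n, (Y : Set V) ⊆ (X n : Set V) := by
    refine (Directed.exists_mem_subset_of_finset_subset_biUnion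
      (f := fun n => (X n : Set V)) (Monotone.directed_le fun a b hab => ?_) (hY.trans ?_))
    · exact Finset.coe_subset.mpr (hXmono hab)
    · rintro _ ⟨n, rfl⟩
      exact Set.mem_iUnion.mpr ⟨n + 1, Finset.mem_image_of_mem e (by simp)⟩
  obtain ⟨k, hk⟩ := hR n
  exact ⟨k, fun m hm => ⟨(hk m hm).1, f.anti _ _ (Finset.coe_subset.mp hn) (hk m hm).2⟩⟩

/-- In a linked set `U`, the vertices of a component of `G - X` that lie in `U` cannot be separated
by a finite set meeting `U` in `X` only. -/
theorem Linked.mem_of_mem {U : Set V} (hlink : G.Linked U) {X Z : Finset V}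
    (hX : (X : Set V) ⊆ U) (hZ : ∀ z ∈ Z, z ∈ U → z ∈ X) {C : G.ComponentCompl (X : Set V)}
    {D : G.ComponentCompl (Z : Set V)} {u v : V} (hu : u ∈ U) (hv : v ∈ U)
    (huC : u ∈ C) (hvC : v ∈ C) (huD : u ∈ D) : v ∈ D := by
  obtain ⟨p, hp⟩ := hlink X hX C u hu v hv huC hvC
  refine ComponentCompl.mem_end_of_walk p huD fun w hw hwZ => ?_
  exact ComponentCompl.notMem_of_mem (hp w hw).2 (hZ w hwZ (hp w hw).1)

/-- If a direction chooses only components meeting the countable linked set `U`, then it is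
induced by a ray of which a tail lies in `U`. -/
theorem Direction.exists_ray_of_forall_meet (f : G.Direction) {U : Set V} (hU : U.Countable)
    (hlink : G.Linked U) (hmeet : ∀ Z : Finset V, ∃ u ∈ U, u ∈ f.comp Z) :
    ∃ R : G.Ray, R.direction = f := by
  classical
  obtain ⟨R, hR⟩ := f.exists_ray_of_linked hU hlink fun X _ => hmeet X
  refine ⟨R, Direction.ext (funext fun Z => Ray.direction_comp_eq_iff.mpr ?_)⟩
  let X := Z.filter (· ∈ U)
  have hX : (X : Set V) ⊆ U := fun x hx => (Finset.mem_filter.mp hx).2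
  obtain ⟨k, hk⟩ := hR X hX
  obtain ⟨u, hu, huZ⟩ := hmeet Z
  exact ⟨k, fun m hm => hlink.mem_of_mem hX (fun z hz hzU => Finset.mem_filter.mpr ⟨hz, hzU⟩) hu
    (hk m hm).1 (f.anti _ _ (Finset.filter_subset _ _) huZ) (hk m hm).2 huZ⟩

/-- Every direction of a graph is induced by a ray. -/
theorem Direction.exists_ray (f : G.Direction) : ∃ R : G.Ray, R.direction = f := by
  classical
  -- `D` consists of the vertices that no finite set avoiding them separates from `f`.
  let D : Set V := {v | ∀ X : Finset V, v ∉ X → v ∈ f.comp X}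
  obtain ⟨D₀, hD₀D, hD₀c, hD₀⟩ : ∃ D₀ ⊆ D, D₀.Countable ∧ (D₀.Finite → D₀ = D) := by
    by_cases hD : D.Finite
    · exact ⟨D, subset_rfl, hD.countable, fun _ => rfl⟩
    · let e := Set.Infinite.natEmbedding D hD
      refine ⟨Set.range fun n => (e n : V), ?_, Set.countable_range _, fun h => ?_⟩
      · rintro _ ⟨n, rfl⟩
        exact (e n).2
      · exact (Set.infinite_range_of_injective (Subtype.val_injective.comp e.injective) h).elim
  have hsep : ∀ v, ∃ X : Finset V, v ∉ D → v ∉ X ∧ v ∉ f.comp X := by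
    intro v
    by_cases hv : v ∈ D
    · exact ⟨∅, fun h => (h hv).elim⟩
    · simp only [D, Set.mem_ofPred_eq, not_forall] at hv
      obtain ⟨X, h₁, h₂⟩ := hv
      exact ⟨X, fun _ => ⟨h₁, h₂⟩⟩
  choose X hX using hsep
  choose b hb using fun Z : Finset V => (f.comp Z).nonempty
  obtain ⟨U, hDU, hU, hlink, hcl⟩ := exists_countable_linked (G := G) D₀ hD₀c
    (fun F => {b F} ∪ ⋃ v ∈ F, (X v : Set V)) (fun F =>
      (Set.countable_singleton _).union
        (F.countable_toSet.biUnion fun v _ => (X v).countable_toSet))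
  have hbU : ∀ F : Finset V, (F : Set V) ⊆ U → b F ∈ U := fun F hF => hcl F hF (Or.inl rfl)
  have hXU : ∀ v ∈ U, (X v : Set V) ⊆ U := fun v hv x hx =>
    hcl {v} (by simpa using hv) (Or.inr (by simpa using hx))
  refine f.exists_ray_of_forall_meet hU hlink fun Z => ?_
  -- A component `f.comp Z` avoiding `U` forces `D₀ ⊆ Z`, so `D₀` is finite and equals `D`.
  by_contra! hZ
  have hZU : ∀ v ∈ f.comp Z, v ∉ U := fun v hv hvU => hZ v hvU hv
  have hDZ : D₀ ⊆ Z := fun d hd => by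
    by_contra hdZ
    exact hZ d (hDU hd) (hD₀D hd Z hdZ)
  have hfin : D₀.Finite := Z.finite_toSet.subset hDZ
  have hEq := hD₀ hfin
  let F := hfin.toFinset
  have hF : (F : Set V) = D₀ := hfin.coe_toFinset
  have hFZ : F ⊆ Z := Finset.coe_subset.mp (hF.trans_subset hDZ)
  have hkF : b Z ∈ f.comp F := f.anti _ _ hFZ (hb Z)
  have huU : b F ∈ U := hbU F (hF.trans_subset hDU)
  let K : G.ComponentCompl U := G.componentComplMk (hZU _ (hb Z))
  have hkK : b Z ∈ K := G.componentComplMk_mem _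
  obtain ⟨p, hp⟩ := ComponentCompl.exists_walk hkF (hb F)
  -- The walk joins `K` to `U` within `f.comp F`, so it leaves `K` at a vertex `y` of `U` outside
  -- `D`. Then `X y ⊆ U` should separate `y` from `f`, yet `K` lies in `f.comp (X y)` and is
  -- adjacent to `y`.
  obtain ⟨x, y, -, hyF, hxK, hyK, hxy⟩ := ComponentCompl.exists_boundary p (S := (K : Set V)) hp hkK
    fun h => ComponentCompl.notMem_of_mem h huU
  have hyU : y ∈ U := by
    by_contra hyU
    exact hyK (ComponentCompl.mem_of_adj x y hxK hyU hxy)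
  have hyD : y ∉ D := by
    rw [← hEq, ← hF]
    exact ComponentCompl.notMem_of_mem hyF
  have hXy := hXU y hyU
  have hkX : b Z ∈ f.comp (X y) :=
    f.mem_of_avoids (fun v hv hvX => hZU v hv (hXy hvX)) (hb Z)
  have hxX : x ∈ f.comp (X y) := ComponentCompl.subset_of_avoids
    (fun v hv hvX => ComponentCompl.notMem_of_mem hv (hXy hvX)) hkK hkX hxK
  exact (hX y hyD).2 (ComponentCompl.mem_of_adj x y hxX (hX y hyD).1 hxy)

/-! ### The end space in terms of directions -/

/-- The direction induced by an end. -/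
noncomputable def EndSpace.direction (ω : G.EndSpace) : G.Direction :=
  Quotient.lift Ray.direction (fun _ _ h => Ray.direction_eq_iff.mpr h) ω

theorem EndSpace.direction_injective :
    Function.Injective (EndSpace.direction : G.EndSpace → G.Direction) := by
  intro ω η h
  induction ω using Quotient.inductionOn with | _ R
  induction η using Quotient.inductionOn with | _ S
  exact Quotient.sound (Ray.direction_eq_iff.mp h)

theorem EndSpace.direction_surjective :
    Function.Surjective (EndSpace.direction : G.EndSpace → G.Direction) := fun f =>
  let ⟨R, hR⟩ := f.exists_ray
  ⟨Quotient.mk _ R, hR⟩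

theorem mem_endsIn_iff {X : Finset V} {C : G.ComponentCompl (X : Set V)} {ω : G.EndSpace} :
    ω ∈ G.endsIn X C ↔ ω.direction.comp X = C := by
  constructor
  · induction ω using Quotient.inductionOn with | _ R
    exact fun h => Ray.direction_comp_eq_iff.mpr (h R rfl)
  · rintro h R rfl
    exact Ray.direction_comp_eq_iff.mp h

theorem isTopologicalBasis_endsIn (G : SimpleGraph V) :
    TopologicalSpace.IsTopologicalBasis
      {U | ∃ (X : Finset V) (C : G.ComponentCompl (X : Set V)), U = G.endsIn X C} where
  exists_subset_inter := by
    classical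
    rintro _ ⟨X, C, rfl⟩ _ ⟨Y, D, rfl⟩ ω ⟨hX, hY⟩
    rw [mem_endsIn_iff] at hX hY
    refine ⟨_, ⟨X ∪ Y, ω.direction.comp (X ∪ Y), rfl⟩, mem_endsIn_iff.mpr rfl, fun η hη => ?_⟩
    rw [mem_endsIn_iff] at hη
    obtain ⟨v, hv⟩ := (ω.direction.comp (X ∪ Y)).nonempty
    have hv' : v ∈ η.direction.comp (X ∪ Y) := hη ▸ hv
    rw [Set.mem_inter_iff, mem_endsIn_iff, mem_endsIn_iff, ← hX, ← hY]
    exact ⟨ComponentCompl.eq_of_mem (η.direction.anti _ _ Finset.subset_union_left hv')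
        (ω.direction.anti _ _ Finset.subset_union_left hv),
      ComponentCompl.eq_of_mem (η.direction.anti _ _ Finset.subset_union_right hv')
        (ω.direction.anti _ _ Finset.subset_union_right hv)⟩
  sUnion_eq := Set.eq_univ_of_forall fun ω =>
    ⟨_, ⟨∅, ω.direction.comp ∅, rfl⟩, mem_endsIn_iff.mpr rfl⟩
  eq_generateFrom := rfl

/-- A countable basis can be extracted from the sets `endsIn X C`. A member containing `ω` and
included in a neighbourhood of `ω` that misses `η` is a choice distinguishing their directions. -/
theorem countablyDetermined_of_secondCountable [SecondCountableTopology G.EndSpace] :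
    G.CountablyDetermined := by
  obtain ⟨B, hB, hBc, hbasis⟩ := (isTopologicalBasis_endsIn G).exists_countable
  have hB' : ∀ b : B, ∃ c : G.DirectionalChoice, (b : Set G.EndSpace) = G.endsIn c.X c.C := by
    rintro ⟨b, hb⟩
    obtain ⟨X, C, h⟩ := hB hb
    exact ⟨⟨X, C⟩, h⟩
  choose c hc using hB'
  have := hBc.to_subtype
  refine ⟨Set.range c, Set.countable_range c, fun f h hne => ?_⟩
  obtain ⟨ω, rfl⟩ := EndSpace.direction_surjective f
  obtain ⟨η, rfl⟩ := EndSpace.direction_surjective h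
  obtain ⟨Z, hZ⟩ : ∃ Z, ω.direction.comp Z ≠ η.direction.comp Z := by
    by_contra! h
    exact hne (Direction.ext (funext h))
  obtain ⟨b, hb, hωb, hbZ⟩ := hbasis.mem_nhds_iff.mp
    (((isTopologicalBasis_endsIn G).isOpen ⟨Z, ω.direction.comp Z, rfl⟩).mem_nhds
      (mem_endsIn_iff.mpr rfl))
  refine ⟨c ⟨b, hb⟩, Set.mem_range_self _, ?_, fun h => ?_⟩
  · exact mem_endsIn_iff.mp (hc ⟨b, hb⟩ ▸ hωb)
  · exact hZ (mem_endsIn_iff.mp (hbZ ((hc ⟨b, hb⟩).ge (mem_endsIn_iff.mpr h)))).symm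

/-! ### Countably determined graphs -/

/-- The set `S` of directional choices distinguishes every two directions from each other. -/
def DistinguishesDirections (G : SimpleGraph V) (S : Set G.DirectionalChoice) : Prop :=
  ∀ f h : G.Direction, f ≠ h → ∃ c ∈ S, c.Distinguishes f h

/-- Deleting a finite vertex set from a graph whose directions are distinguished by countably many
choices leaves only countably many components that are chosen by directions. -/
theorem DistinguishesDirections.countable_comp {S : Set G.DirectionalChoice}
    (hS : G.DistinguishesDirections S) (hSc : S.Countable) (X : Finset V) :
    {C : G.ComponentCompl (X : Set V) | ∃ f : G.Direction, f.comp X = C}.Countable := by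
  classical
  let N : G.ComponentCompl (X : Set V) → Finset V :=
    fun C => X.filter fun x => ∃ c ∈ C, G.Adj c x
  let U : Set V := ⋃ c ∈ S, (c.X : Set V)
  have hU : U.Countable := hSc.biUnion fun c _ => c.X.countable_toSet
  have hmeet : {C : G.ComponentCompl (X : Set V) | ∃ u ∈ U, u ∈ C}.Countable := by
    refine (hU.biUnion fun u _ => Set.Subsingleton.countable
      (s := {C : G.ComponentCompl (X : Set V) | u ∈ C})
      fun C hC D hD => ComponentCompl.eq_of_mem hC hD).mono ?_
    rintro C ⟨u, hu, huC⟩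
    exact Set.mem_biUnion hu huC
  have hfiber : ∀ M : Finset V, {C : G.ComponentCompl (X : Set V) |
      (∃ f : G.Direction, f.comp X = C) ∧ (∀ u ∈ U, u ∉ C) ∧ N C = M}.Countable := by
    intro M
    rcases Set.subsingleton_or_nontrivial {C : G.ComponentCompl (X : Set V) |
      (∃ f : G.Direction, f.comp X = C) ∧ (∀ u ∈ U, u ∉ C) ∧ N C = M} with hsub | hnt
    · exact hsub.countable
    -- With a second component in the same class, each `C` turns out to be, as a vertex set, the
    -- component of some choice in `S`.
    · refine Set.MapsTo.countable_of_injOn (f := fun C => (C : Set V)) ?_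
        (SetLike.coe_injective.injOn) (hSc.image fun c => (c.C : Set V))
      intro C hC
      obtain ⟨C', hC', hne⟩ := hnt.exists_ne C
      obtain ⟨⟨f, hf⟩, hCU, hN⟩ := hC
      obtain ⟨⟨f', hf'⟩, hCU', hN'⟩ := hC'
      have hff' : f ≠ f' := fun h => hne (by rw [← hf, ← hf', h])
      obtain ⟨c, hcS, hc, hc'⟩ := hS f f' hff'
      have hYU : (c.X : Set V) ⊆ U := Set.subset_biUnion_of_mem (u := fun c : G.DirectionalChoice =>
        (c.X : Set V)) hcS
      subst hf hf'
      have hCD : ∀ v ∈ f.comp X, v ∈ c.C := fun v hv =>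
        hc ▸ f.mem_of_avoids (fun v hv hvY => hCU v (hYU hvY) hv) hv
      have hCD' : ∀ v ∈ f'.comp X, v ∈ f'.comp c.X := fun v hv =>
        f'.mem_of_avoids (fun v hv hvY => hCU' v (hYU hvY) hv) hv
      -- A vertex of `M` outside `c.X` would be adjacent to both components and so join them in `G -
      -- c.X`, although `c` distinguishes their directions.
      have hMY : ∀ x ∈ M, x ∈ (c.X : Set V) := by
        intro x hx
        by_contra hxY
        have h1 := hx
        have h2 := hx
        rw [← hN] at h1
        rw [← hN'] at h2
        obtain ⟨-, y, hy, hyx⟩ := Finset.mem_filter.mp h1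
        obtain ⟨-, y', hy', hyx'⟩ := Finset.mem_filter.mp h2
        exact hc' (ComponentCompl.eq_of_mem
          (ComponentCompl.mem_of_adj _ _ (hCD' _ hy') hxY hyx')
          (ComponentCompl.mem_of_adj _ _ (hCD _ hy) hxY hyx))
      -- All neighbours of `f.comp X` lie in `M`, which `c.X` includes, so `c.C` cannot extend
      -- beyond `f.comp X`.
      refine ⟨c, hcS, Set.Subset.antisymm (fun v hv => ?_) hCD⟩
      by_contra hvC
      obtain ⟨u, hu⟩ := (f.comp X).nonempty
      obtain ⟨p, hp⟩ := ComponentCompl.exists_walk (hCD u hu) hv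
      obtain ⟨x, y, -, hyD, hx, hy, hxy⟩ := ComponentCompl.exists_boundary p hp hu hvC
      by_cases hyX : y ∈ X
      · exact ComponentCompl.notMem_of_mem hyD
          (hMY y (hN ▸ Finset.mem_filter.mpr ⟨hyX, x, hx, hxy⟩))
      · exact hy (ComponentCompl.mem_of_adj x y hx hyX hxy)
  refine (hmeet.union (X.powerset.countable_toSet.biUnion fun M _ => hfiber M)).mono ?_
  intro C hC
  by_cases h : ∃ u ∈ U, u ∈ C
  · exact Or.inl h
  · push Not at h
    exact Or.inr (Set.mem_biUnion (x := N C)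
      (Finset.mem_powerset.mpr (Finset.filter_subset _ _)) ⟨hC, h, rfl⟩)

/-- A direction of `G` that always chooses components meeting `U` when deleting finitely many
vertices of `U` does so when deleting any finite vertex set. -/
theorem DistinguishesDirections.forall_meet {S : Set G.DirectionalChoice}
    (hS : G.DistinguishesDirections S) {U : Set V} (hU : U.Countable) (hlink : G.Linked U)
    (hSU : ∀ c ∈ S, (c.X : Set V) ⊆ U) (f : G.Direction)
    (hf : ∀ X : Finset V, (X : Set V) ⊆ U → ∃ u ∈ U, u ∈ f.comp X) (Z : Finset V) :
    ∃ u ∈ U, u ∈ f.comp Z := by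
  obtain ⟨R, hR⟩ := f.exists_ray_of_linked hU hlink hf
  -- The ray follows `f` at every `c.X` with `c ∈ S`, so no choice distinguishes `f` from the
  -- direction of `R`.
  have hRf : f = R.direction := by
    by_contra hne
    obtain ⟨c, hc, h₁, h₂⟩ := hS _ _ hne
    refine h₂ (Ray.direction_comp_eq_iff.mpr ?_)
    obtain ⟨k, hk⟩ := hR c.X (hSU c hc)
    exact ⟨k, fun m hm => h₁ ▸ (hk m hm).2⟩
  obtain ⟨n, hn⟩ := Ray.direction_comp_eq_iff.mp (congrArg (fun g => g.comp Z) hRf.symm)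
  obtain ⟨k, hk⟩ := hR ∅ (by simp)
  exact ⟨_, (hk (max n k) (le_max_right _ _)).1, hn _ (le_max_left _ _)⟩

/-- The choices of a direction for the finite subsets of `U` determine its choice for `Z` in a
finitary way. -/
theorem DistinguishesDirections.exists_subset {S : Set G.DirectionalChoice}
    (hS : G.DistinguishesDirections S) {U : Set V} (hU : U.Countable) (hlink : G.Linked U)
    (hSU : ∀ c ∈ S, (c.X : Set V) ⊆ U) (f : G.Direction) (Z : Finset V) :
    ∃ X : Finset V, (X : Set V) ⊆ U ∧
      ∀ h : G.Direction, h.comp X = f.comp X → h.comp Z = f.comp Z := by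
  classical
  -- If some `f.comp X` avoids `U`, it lies in `f.comp c.X` for every `c ∈ S`, so a direction
  -- agreeing with `f` at `X` is `f` itself.
  by_cases hf : ∀ X : Finset V, (X : Set V) ⊆ U → ∃ u ∈ U, u ∈ f.comp X
  swap
  · push Not at hf
    obtain ⟨X, hX, hfX⟩ := hf
    refine ⟨X, hX, fun h hh => ?_⟩
    suffices f = h by rw [this]
    by_contra hne
    obtain ⟨c, hc, h₁, h₂⟩ := hS _ _ hne
    refine h₂ ?_
    have hav : ∀ v ∈ f.comp X, v ∉ (c.X : Set V) := fun v hv hvc => hfX v (hSU c hc hvc) hv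
    obtain ⟨v, hv⟩ := (f.comp X).nonempty
    exact ComponentCompl.eq_of_mem (h.mem_of_avoids (hh ▸ hav) (hh ▸ hv))
      (h₁ ▸ f.mem_of_avoids hav hv)
  -- `Y z` separates `z` from `U` by finitely many vertices of `U` whenever this is possible.
  -- Including these sets in `X` excludes directions that leave `U` behind a vertex of `Z`.
  have hY : ∀ z, ∃ Y : Finset V, (Y : Set V) ⊆ U ∧
      ((∃ (Y' : Finset V) (C : G.ComponentCompl (Y' : Set V)), (Y' : Set V) ⊆ U ∧ z ∈ C ∧
        ∀ u ∈ C, u ∉ U) → ∃ C : G.ComponentCompl (Y : Set V), z ∈ C ∧ ∀ u ∈ C, u ∉ U) := by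
    intro z
    by_cases h : ∃ (Y' : Finset V) (C : G.ComponentCompl (Y' : Set V)), (Y' : Set V) ⊆ U ∧ z ∈ C ∧
        ∀ u ∈ C, u ∉ U
    · obtain ⟨Y, C, h₁, h₂, h₃⟩ := h
      exact ⟨Y, h₁, fun _ => ⟨C, h₂, h₃⟩⟩
    · exact ⟨∅, by simp, fun h' => (h h').elim⟩
  choose Y hYU hY using hY
  let X := Z.filter (· ∈ U) ∪ Z.biUnion Y
  have hXU : (X : Set V) ⊆ U := by
    intro x hx
    rcases Finset.mem_union.mp hx with hx | hx
    · exact (Finset.mem_filter.mp hx).2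
    · obtain ⟨z, -, hz⟩ := Finset.mem_biUnion.mp hx
      exact hYU z hz
  have hZX : ∀ z ∈ Z, z ∈ U → z ∈ X := fun z hz hzU =>
    Finset.mem_union_left _ (Finset.mem_filter.mpr ⟨hz, hzU⟩)
  have hYX : ∀ z ∈ Z, Y z ⊆ X := fun z hz =>
    (Finset.subset_biUnion_of_mem Y hz).trans Finset.subset_union_right
  refine ⟨X, hXU, fun h hh => ?_⟩
  obtain ⟨u, huU, hu⟩ := hS.forall_meet hU hlink hSU f hf (X ∪ Z)
  have huX : u ∈ f.comp X := f.anti _ _ Finset.subset_union_left hu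
  have huZ : u ∈ f.comp Z := f.anti _ _ Finset.subset_union_right hu
  -- If `h.comp (X ∪ Z)` meets `U`, linkedness joins that vertex to `u` inside `U` and off `X`,
  -- hence off `Z`.
  suffices ∃ v ∈ U, v ∈ h.comp (X ∪ Z) by
    obtain ⟨v, hvU, hv⟩ := this
    have hvX : v ∈ f.comp X := hh ▸ h.anti _ _ Finset.subset_union_left hv
    have hvZ : v ∈ h.comp Z := h.anti _ _ Finset.subset_union_right hv
    exact ComponentCompl.eq_of_mem hvZ (hlink.mem_of_mem hXU hZX huU hvU huX hvX huZ)
  by_contra! hK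
  have hKU : ∀ v ∈ h.comp (X ∪ Z), v ∉ U := fun v hv hvU => hK v hvU hv
  obtain ⟨Y', hY'U, hY'⟩ : ∃ Y' : Finset V, (Y' : Set V) ⊆ U ∧ ∀ v ∈ h.comp Y', v ∉ U := by
    by_contra! hcon
    obtain ⟨v, hvU, hv⟩ := hS.forall_meet hU hlink hSU h
      (fun X hX => (hcon X hX).imp fun _ hv => ⟨hv.2, hv.1⟩) (X ∪ Z)
    exact hK v hvU hv
  obtain ⟨k, hk⟩ := (h.comp (X ∪ Z)).nonempty
  have hkX : k ∈ h.comp X := h.anti _ _ Finset.subset_union_left hk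
  obtain ⟨p, hp⟩ := ComponentCompl.exists_walk hkX (hh ▸ huX : u ∈ h.comp X)
  -- The walk from `h.comp (X ∪ Z)` to `u` stays off `X`, so it must leave at some `z ∈ Z`. This `z`
  -- lies in `h.comp Y'`, which avoids `U`, so `Y z` separates `z` from `U`; but `Y z ⊆ X` and `z`,
  -- `u` lie in one component of `G - X`.
  obtain ⟨x, z, -, hzX, hx, hz, hxz⟩ := ComponentCompl.exists_boundary p hp hk
    fun hu => hKU u hu huU
  have hzZ : z ∈ Z := by
    by_contra hzZ
    refine hz (ComponentCompl.mem_of_adj x z hx (fun hz' => ?_) hxz)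
    rcases Finset.mem_union.mp hz' with hz' | hz'
    · exact ComponentCompl.notMem_of_mem hzX hz'
    · exact hzZ hz'
  have hzU : z ∉ U := fun hzU => ComponentCompl.notMem_of_mem hzX (hZX z hzZ hzU)
  have hzY' : z ∈ h.comp Y' := ComponentCompl.mem_of_adj x z
    (h.mem_of_avoids (fun v hv hvY => hKU v hv (hY'U hvY)) hx) (fun hzY => hzU (hY'U hzY)) hxz
  obtain ⟨C, hzC, hC⟩ := hY z ⟨Y', h.comp Y', hY'U, hzY', hY'⟩
  refine hC u (ComponentCompl.subset_of_avoids (fun v hv hvY => ?_) hzX hzC (hh ▸ huX)) huU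
  exact ComponentCompl.notMem_of_mem hv (hYX z hzZ hvY)

theorem CountablyDetermined.secondCountable (hG : G.CountablyDetermined) :
    SecondCountableTopology G.EndSpace := by
  obtain ⟨S, hSc, hS⟩ := hG
  replace hS : G.DistinguishesDirections S := hS
  obtain ⟨U, hSU, hU, hlink, -⟩ := exists_countable_linked (G := G) (⋃ c ∈ S, (c.X : Set V))
    (hSc.biUnion fun c _ => c.X.countable_toSet) (fun _ => ∅) (fun _ => Set.countable_empty)
  replace hSU : ∀ c ∈ S, (c.X : Set V) ⊆ U := fun c hc =>
    (Set.subset_biUnion_of_mem (u := fun c : G.DirectionalChoice => (c.X : Set V)) hc).trans hSU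
  -- Only components chosen by directions are kept: the others may be uncountably many, but they
  -- contain no ends.
  let B : Set (Set G.EndSpace) := ⋃ X ∈ {X : Finset V | (X : Set V) ⊆ U},
    G.endsIn X '' {C | ∃ f : G.Direction, f.comp X = C}
  have hB : B.Countable := by
    refine Set.Countable.biUnion ?_ fun X _ => (hS.countable_comp hSc X).image _
    exact Set.MapsTo.countable_of_injOn (f := fun F : Finset V => (F : Set V))
      (t := {T | T.Finite ∧ T ⊆ U}) (fun F hF => ⟨F.finite_toSet, hF⟩) Finset.coe_injective.injOn
      (Set.countable_ofPred_finite_subset hU)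
  refine TopologicalSpace.IsTopologicalBasis.secondCountableTopology
    (TopologicalSpace.isTopologicalBasis_of_isOpen_of_nhds (s := B) ?_ ?_) hB
  · intro b hb
    simp only [B, Set.mem_iUnion] at hb
    obtain ⟨X, -, C, -, rfl⟩ := hb
    exact (isTopologicalBasis_endsIn G).isOpen ⟨X, C, rfl⟩
  · intro ω O hω hO
    obtain ⟨_, ⟨Z, C, rfl⟩, hωC, hCO⟩ :=
      (isTopologicalBasis_endsIn G).mem_nhds_iff.mp (hO.mem_nhds hω)
    obtain ⟨X, hXU, hX⟩ := hS.exists_subset hU hlink hSU ω.direction Z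
    refine ⟨G.endsIn X (ω.direction.comp X), ?_, mem_endsIn_iff.mpr rfl, fun η hη => hCO ?_⟩
    · simp only [B, Set.mem_iUnion]
      exact ⟨X, hXU, _, ⟨_, rfl⟩, rfl⟩
    · exact mem_endsIn_iff.mpr ((hX _ (mem_endsIn_iff.mp hη)).trans (mem_endsIn_iff.mp hωC))

end SimpleGraph

theorem mainTheorem8 {V : Type u} (G : SimpleGraph V) :
    SecondCountableTopology G.EndSpace ↔ G.CountablyDetermined :=
  ⟨fun _ => SimpleGraph.countablyDetermined_of_secondCountable,
    SimpleGraph.CountablyDetermined.secondCountable⟩
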